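/- Let $\mathbb T=\mathbb R/\mathbb Z$, and write $e(\theta)=\exp(2\pi i\theta)$. For a set $S\subset\mathbb N=\{1,2,3,\dots\}$ put $S(N)=S\cap\{1,\dots,N\}$. An infinite set $S\subset\mathbb N$ is called \emph{good} if for every $\beta\in\mathbb T$ the limit $$\lim_{N\to\infty}\frac1{\#S(N)}\sum_{s\in S(N)}e(s\beta)$$ exists. For a good set $S$ and $\alpha\in\mathbb T$, let $\mu_{S,\alpha}$ be the Borel probability measure on $\mathbb T$ that is the weak limit of the measures $\frac1{\#S(N)}\sum_{s\in S(N)}\delta_{s\alpha}$, that is, $\int_{\mathbb T}\varphi\,d\mu_{S,\alpha}=\lim_{N\to\infty}\frac1{\#S(N)}\sum_{s\in S(N)}\varphi(s\alpha)$ for every continuous $\varphi:\mathbb T\to\mathbb C$. A finite Borel measure $\nu$ on $\mathbb T$ is \emph{representable at} $\alpha$ if there is a good set $S$ with $\mu_{S,\alpha}=\frac{1}{\nu(\mathbb T)}\nu$. \textbf{Theorem.} Let $\nu$ be a Borel probability measure on $\mathbb T$ that is absolutely continuous with respect to the Lebesgue probability measure on $\mathbb T$, and let $\alpha$ be an irrational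 number. Then $\nu$ is representable at $\alpha$; that is, there is a good set $S\subset\mathbb N$ with $\mu_{S,\alpha}=\nu$. -/

import Mathlib

namespace RepresentableMeasure

open Filter Topology MeasureTheory

/-- The character `e(θ) = exp (2πiθ)` on the torus `𝕋 = ℝ / ℤ`. -/
noncomputable def e (θ : UnitAddCircle) : ℂ := (AddCircle.toCircle θ : ℂ)

theorem e_coe (x : ℝ) : e (x : UnitAddCircle) = Complex.exp (2 * Real.pi * Complex.I * x) := by
  rw [e, AddCircle.toCircle_apply_mk, Circle.coe_exp]
  push_cast
  congr 1
  ring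

open scoped Classical in
/-- The `N`-th initial segment `S(N) = S ∩ {1, …, N}`. -/
noncomputable def initSegment (S : Set ℕ) (N : ℕ) : Finset ℕ :=
  {n ∈ Finset.Icc 1 N | n ∈ S}

/-- The arithmetic average of `f` over the finite set `A` (`0` if `A` is empty; for an infinite
set of positive integers this affects only finitely many of its initial segments). -/
noncomputable def arithAverage (A : Finset ℕ) (f : ℕ → ℂ) : ℂ :=
  (A.card : ℂ)⁻¹ * ∑ s ∈ A, f s

/-- A good set: an infinite set `S` of positive integers such that the averages of `e(sβ)` over
`S(N)` converge, as `N → ∞`, for every `β` in the torus. -/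
def IsGoodSet (S : Set ℕ) : Prop :=
  (∀ s ∈ S, 1 ≤ s) ∧ S.Infinite ∧
    ∀ β : UnitAddCircle, ∃ l : ℂ,
      Tendsto (fun N : ℕ => arithAverage (initSegment S N) fun s => e (s • β)) atTop (𝓝 l)

/-- `μ` is the weak limit of the transform measures of `S` at `α`: for every continuous
`φ : 𝕋 → ℂ`, the averages of `φ(sα)` over `S(N)` converge to `∫ φ dμ`. -/
def IsLimitMeasure (S : Set ℕ) (α : UnitAddCircle) (μ : Measure UnitAddCircle) : Prop :=
  ∀ φ : C(UnitAddCircle, ℂ),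
    Tendsto (fun N : ℕ => arithAverage (initSegment S N) fun s => φ (s • α)) atTop (𝓝 (∫ x, φ x ∂μ))

/-- The set `S` represents the finite Borel measure `ν` at `α`: `S` is good and its limit measure
at `α` is the normalized measure `ν / ν(𝕋)`. -/
def Represents (S : Set ℕ) (ν : Measure UnitAddCircle) [IsFiniteMeasure ν]
    (α : UnitAddCircle) : Prop :=
  IsGoodSet S ∧ IsLimitMeasure S α ((ν Set.univ)⁻¹ • ν)

/-- The finite Borel measure `ν` is representable at `α`. -/
def IsRepresentableAt (ν : Measure UnitAddCircle) [IsFiniteMeasure ν]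
    (α : UnitAddCircle) : Prop :=
  ∃ S : Set ℕ, Represents S ν α

end RepresentableMeasure

/-! Let `f` be the density of `ν`. Selecting `n` with probability `f (n • α)` would be natural, but
`f` may be unbounded and its values on a single orbit are meaningless. Both defects are cured by
continuous `F j ≥ 0` converging fast to `f` in L¹ and by weights `w n = σ n * F (k n) ((n + 1) •
α)`: since `σ` tends to `0`, the index `k n` can grow so slowly that `w n ≤ 1`
(`IsSlowWeight.exists_weights`).

Let `T N` be the sum of `σ n` over `n < N`. Weighted equidistribution of the orbit shows that the
sums of `w n * e ((n + 1) • β)` over `n < N`, divided by `T N`, tend to `∫ fourier m ∂ν` if `β = m •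
α`, and to `0` if `β` is not a multiple of `α`.

It remains to replace `w` by an indicator function. A greedy deterministic choice
(`exists_rounding`) makes the exponential sums of the difference `O(N ^ (3/4))`, uniformly in the
frequency. For `σ n = (n + 1) ^ (-1/8)` one has `T N ≥ N ^ (7/8)`, so this error is negligible. The
frequency `β = 0` gives `#S(N) ∼ T N`, and division turns the limits into limits of averages. -/

namespace RepresentableMeasure

open Filter Topology MeasureTheory

/-! ### Rounding a sequence of weights to an indicator function -/

/-- A sequence may be defined by prescribing each term as a function of the earlier ones. -/
theorem exists_causal_seq (g : ℕ → (ℕ → ℝ) → ℝ) :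
    ∃ x : ℕ → ℝ, ∀ n, x n = g n fun m => if m < n then x m else 0 := by
  let F : ∀ n, (∀ m, m < n → ℝ) → ℝ := fun n x => g n fun m => if h : m < n then x m h else 0
  refine ⟨fun n => WellFounded.fix Nat.lt_wfRel.wf F n, fun n => ?_⟩
  show WellFounded.fix Nat.lt_wfRel.wf F n = _
  rw [WellFounded.fix_eq]
  simp only [F, dite_eq_ite]

/-- The autocorrelation with lag `h + 1` of the first `N` terms of `x`. -/
noncomputable def autocorr (x : ℕ → ℝ) (N h : ℕ) : ℝ :=
  ∑ n ∈ Finset.range N, if h < n then x n * x (n - 1 - h) else 0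

theorem autocorr_succ (x : ℕ → ℝ) {N h : ℕ} (hN : h < N) :
    autocorr x (N + 1) h = autocorr x N h + x N * x (N - 1 - h) := by
  rw [autocorr, Finset.sum_range_succ, if_pos hN, autocorr]

theorem autocorr_eq_zero (x : ℕ → ℝ) {N h : ℕ} (hN : N ≤ h + 1) : autocorr x N h = 0 := by
  refine Finset.sum_eq_zero fun n hn => if_neg ?_
  have := Finset.mem_range.1 hn
  omega

theorem autocorr_congr {x y : ℕ → ℝ} {N : ℕ} (hxy : ∀ n < N, x n = y n) (h : ℕ) :
    autocorr x N h = autocorr y N h := by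
  refine Finset.sum_congr rfl fun n hn => ?_
  have := Finset.mem_range.1 hn
  split_ifs
  · rw [hxy n this, hxy _ (by omega)]
  · rfl

/-- Expand the square and group the pairs of indices by their difference: as `z` is unimodular, the
phase of a pair depends on nothing else. -/
theorem sq_norm_sum_mul_pow (x : ℕ → ℝ) (N : ℕ) {z : ℂ} (hz : ‖z‖ = 1) :
    ‖∑ n ∈ Finset.range N, (x n : ℂ) * z ^ n‖ ^ 2 =
      ∑ n ∈ Finset.range N, x n ^ 2 +
        2 * ∑ h ∈ Finset.range N, autocorr x N h * (z ^ (h + 1)).re := by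
  have hzc : z * (starRingEnd ℂ) z = 1 := by rw [Complex.mul_conj, Complex.normSq_eq_norm_sq, hz]; simp
  induction N with
  | zero => simp
  | succ N ih =>
    have hcross : ((∑ n ∈ Finset.range N, (x n : ℂ) * z ^ n) *
        (starRingEnd ℂ) ((x N : ℂ) * z ^ N)).re =
        ∑ h ∈ Finset.range N, x N * x (N - 1 - h) * (z ^ (h + 1)).re := by
      rw [← Finset.sum_range_reflect (fun n => (x n : ℂ) * z ^ n), Finset.sum_mul, Complex.re_sum]
      refine Finset.sum_congr rfl fun h hh => ?_
      have hh := Finset.mem_range.1 hh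
      have hsplit : z ^ N = z ^ (N - 1 - h) * z ^ (h + 1) := by rw [← pow_add]; congr 1; omega
      have hunit : z ^ (N - 1 - h) * (starRingEnd ℂ) (z ^ (N - 1 - h)) = 1 := by
        rw [map_pow, ← mul_pow, hzc, one_pow]
      have : (x (N - 1 - h) : ℂ) * z ^ (N - 1 - h) * (starRingEnd ℂ) ((x N : ℂ) * z ^ N) =
          ((x N * x (N - 1 - h) : ℝ) : ℂ) * (starRingEnd ℂ) (z ^ (h + 1)) := by
        rw [hsplit, map_mul, map_mul, Complex.conj_ofReal]
        push_cast
        linear_combination (x N : ℂ) * x (N - 1 - h) * (starRingEnd ℂ) (z ^ (h + 1)) * hunit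
      rw [this, Complex.re_ofReal_mul, Complex.conj_re]
    have hsq : ‖(x N : ℂ) * z ^ N‖ ^ 2 = x N ^ 2 := by
      rw [norm_mul, norm_pow, hz, one_pow, mul_one, Complex.norm_real, Real.norm_eq_abs, sq_abs]
    rw [Finset.sum_range_succ, ← Complex.normSq_eq_norm_sq, Complex.normSq_add,
      Complex.normSq_eq_norm_sq, Complex.normSq_eq_norm_sq, ih, hsq, hcross,
      Finset.sum_range_succ (fun n => x n ^ 2), Finset.sum_range_succ _ N,
      autocorr_eq_zero x (N := N + 1) (h := N) le_rfl, zero_mul, add_zero]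
    have : ∑ h ∈ Finset.range N, autocorr x (N + 1) h * (z ^ (h + 1)).re =
        ∑ h ∈ Finset.range N, autocorr x N h * (z ^ (h + 1)).re +
          ∑ h ∈ Finset.range N, x N * x (N - 1 - h) * (z ^ (h + 1)).re := by
      rw [← Finset.sum_add_distrib]
      refine Finset.sum_congr rfl fun h hh => ?_
      rw [autocorr_succ x (Finset.mem_range.1 hh), add_mul]
    rw [this]
    ring

/-- The sum of the squares of the autocorrelations grows slowly if each new term has a sign
opposite to its correlation with the past. -/
theorem sum_sq_autocorr_le {x : ℕ → ℝ} (hx : ∀ n, |x n| ≤ 1)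
    (hneg : ∀ n, x n * ∑ h ∈ Finset.range n, autocorr x n h * x (n - 1 - h) ≤ 0) (N : ℕ) :
    ∑ h ∈ Finset.range N, autocorr x N h ^ 2 ≤ (N : ℝ) ^ 2 := by
  have hsq : ∀ n, x n ^ 2 ≤ 1 := fun n => (sq_le_one_iff_abs_le_one _).2 (hx n)
  induction N with
  | zero => simp
  | succ N ih =>
    rw [Finset.sum_range_succ, autocorr_eq_zero x (N := N + 1) (h := N) le_rfl]
    -- The cross term is the quantity whose sign `hneg` prescribes, so one step adds at most `N` to
    -- the sum of squares.
    have hexp : ∑ h ∈ Finset.range N, autocorr x (N + 1) h ^ 2 =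
        ∑ h ∈ Finset.range N, autocorr x N h ^ 2 +
          2 * (x N * ∑ h ∈ Finset.range N, autocorr x N h * x (N - 1 - h)) +
          ∑ h ∈ Finset.range N, (x N * x (N - 1 - h)) ^ 2 := by
      rw [Finset.mul_sum, Finset.mul_sum, ← Finset.sum_add_distrib, ← Finset.sum_add_distrib]
      refine Finset.sum_congr rfl fun h hh => ?_
      rw [autocorr_succ x (Finset.mem_range.1 hh)]
      ring
    have hlast : ∑ h ∈ Finset.range N, (x N * x (N - 1 - h)) ^ 2 ≤ N := by
      calc _ ≤ ∑ _h ∈ Finset.range N, (1 : ℝ) := by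
            refine Finset.sum_le_sum fun h _ => ?_
            rw [mul_pow]
            exact mul_le_one₀ (hsq _) (sq_nonneg _) (hsq _)
        _ = N := by simp
    have := hneg N
    push_cast
    rw [hexp]
    nlinarith

/-- Weights in `[0, 1]` can be rounded to an indicator function with a small error, uniformly over
all characters. -/
theorem exists_rounding (w : ℕ → ℝ) (h0 : ∀ n, 0 ≤ w n) (h1 : ∀ n, w n ≤ 1) :
    ∃ A : Set ℕ, ∀ (N : ℕ) (z : ℂ), ‖z‖ = 1 →
      ‖∑ n ∈ Finset.range N, ((A.indicator 1 n - w n : ℝ) : ℂ) * z ^ n‖ ^ 2 ≤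
        N + 2 * (Real.sqrt N * N) := by
  -- The two admissible values `1 - w n ≥ 0` and `-w n ≤ 0` have opposite signs, so one of them
  -- always opposes the correlation with the past.
  obtain ⟨x, hx⟩ := exists_causal_seq fun n y =>
    if ∑ h ∈ Finset.range n, autocorr y n h * y (n - 1 - h) ≤ 0 then 1 - w n else -w n
  have hpast : ∀ n, ∑ h ∈ Finset.range n, autocorr (fun m => if m < n then x m else 0) n h *
      (if n - 1 - h < n then x (n - 1 - h) else 0) =
      ∑ h ∈ Finset.range n, autocorr x n h * x (n - 1 - h) := by
    intro n
    refine Finset.sum_congr rfl fun h hh => ?_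
    have := Finset.mem_range.1 hh
    rw [autocorr_congr (y := x) (fun m hm => if_pos hm), if_pos (by omega)]
  simp only [hpast] at hx
  let A : Set ℕ := {n | ∑ h ∈ Finset.range n, autocorr x n h * x (n - 1 - h) ≤ 0}
  have hxA : ∀ n, A.indicator 1 n - w n = x n := by
    intro n
    rw [hx n]
    by_cases hn : n ∈ A
    · rw [Set.indicator_of_mem hn, Pi.one_apply]; exact (if_pos hn).symm
    · rw [Set.indicator_of_notMem hn, zero_sub]; exact (if_neg hn).symm
  have hbound : ∀ n, |x n| ≤ 1 := by
    intro n
    have := h0 n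
    have := h1 n
    rw [hx n, abs_le]
    split_ifs <;> constructor <;> linarith
  have hneg : ∀ n, x n * ∑ h ∈ Finset.range n, autocorr x n h * x (n - 1 - h) ≤ 0 := by
    intro n
    have hw0 := h0 n
    have hw1 := h1 n
    rcases le_or_gt (∑ h ∈ Finset.range n, autocorr x n h * x (n - 1 - h)) 0 with h | h
    · have : x n = 1 - w n := by rw [hx n, if_pos h]
      rw [this]
      exact mul_nonpos_of_nonneg_of_nonpos (by linarith) h
    · have : x n = -w n := by rw [hx n, if_neg (not_le.2 h)]
      rw [this]
      exact mul_nonpos_of_nonpos_of_nonneg (by linarith) h.le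
  refine ⟨A, fun N z hz => ?_⟩
  simp only [hxA]
  rw [sq_norm_sum_mul_pow x N hz]
  have hsum : ∑ n ∈ Finset.range N, x n ^ 2 ≤ N := by
    calc _ ≤ ∑ _n ∈ Finset.range N, (1 : ℝ) :=
          Finset.sum_le_sum fun n _ => (sq_le_one_iff_abs_le_one _).2 (hbound n)
      _ = N := by simp
  -- Cauchy–Schwarz over the lags removes the dependence on `z`.
  have hcorr : ∑ h ∈ Finset.range N, autocorr x N h * (z ^ (h + 1)).re ≤ Real.sqrt N * N := by
    calc _ ≤ Real.sqrt (∑ h ∈ Finset.range N, autocorr x N h ^ 2) *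
          Real.sqrt (∑ h ∈ Finset.range N, (z ^ (h + 1)).re ^ 2) :=
          Real.sum_mul_le_sqrt_mul_sqrt _ _ _
      _ ≤ N * Real.sqrt N := by
          refine mul_le_mul ?_ (Real.sqrt_le_sqrt ?_) (Real.sqrt_nonneg _) (Nat.cast_nonneg _)
          · exact Real.sqrt_le_iff.2 ⟨Nat.cast_nonneg _, sum_sq_autocorr_le hbound hneg N⟩
          · calc _ ≤ ∑ _h ∈ Finset.range N, (1 : ℝ) := by
                  refine Finset.sum_le_sum fun h _ => (sq_le_one_iff_abs_le_one _).2 ?_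
                  exact (Complex.abs_re_le_norm _).trans (by rw [norm_pow, hz, one_pow])
              _ = N := by simp
      _ = Real.sqrt N * N := mul_comm _ _
  linarith

/-! ### Weighted means along the orbit of a rotation -/

theorem e_nsmul (β : UnitAddCircle) (n : ℕ) : e (n • β) = e β ^ n := by
  rw [e, AddCircle.toCircle_nsmul, Circle.coe_pow, e]

theorem norm_e (β : UnitAddCircle) : ‖e β‖ = 1 := Circle.norm_coe _

theorem e_add (β γ : UnitAddCircle) : e (β + γ) = e β * e γ := by
  rw [e, AddCircle.toCircle_add, Circle.coe_mul, e, e]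

theorem e_eq_one_iff {β : UnitAddCircle} : e β = 1 ↔ β = 0 := by
  rw [e, Circle.coe_eq_one, ← AddCircle.toCircle_zero (T := 1)]
  exact (AddCircle.injective_toCircle one_ne_zero).eq_iff

theorem fourier_eq_e (m : ℤ) (x : UnitAddCircle) : fourier m x = e (m • x) := fourier_apply

theorem fourier_nsmul (m : ℤ) (n : ℕ) (x : UnitAddCircle) :
    fourier m (n • x) = e (m • x) ^ n := by
  rw [fourier_eq_e, smul_comm, e_nsmul]

theorem norm_fourier_apply (m : ℤ) (x : UnitAddCircle) : ‖fourier m x‖ = 1 := by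
  rw [fourier_eq_e, norm_e]

theorem integral_fourier_eq_zero {m : ℤ} (hm : m ≠ 0) :
    ∫ x : UnitAddCircle, fourier m x = 0 :=
  integral_eq_zero_of_add_right_eq_neg (fourier_add_half_inv_index hm one_pos)

instance : IsProbabilityMeasure (volume : Measure UnitAddCircle) :=
  ⟨UnitAddCircle.measure_univ⟩

/-- The mean of the first `N` terms of `u` with weights `σ`. -/
noncomputable def weightedMean (σ : ℕ → ℝ) (u : ℕ → ℂ) (N : ℕ) : ℂ :=
  ∑ n ∈ Finset.range N, (((∑ k ∈ Finset.range N, σ k)⁻¹ * σ n : ℝ) : ℂ) * u n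

theorem weightedMean_eq (σ : ℕ → ℝ) (u : ℕ → ℂ) (N : ℕ) :
    weightedMean σ u N =
      ((∑ k ∈ Finset.range N, σ k)⁻¹ : ℝ) * ∑ n ∈ Finset.range N, (σ n : ℂ) * u n := by
  rw [weightedMean, Finset.mul_sum]
  refine Finset.sum_congr rfl fun n _ => ?_
  push_cast
  ring

/-- A sequence of positive weights, decreasing to `0` but not summable. -/
structure IsSlowWeight (σ : ℕ → ℝ) : Prop where
  antitone : Antitone σ
  tendsto_zero : Tendsto σ atTop (𝓝 0)
  pos : ∀ n, 0 < σ n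
  tendsto_sum : Tendsto (fun N => ∑ n ∈ Finset.range N, σ n) atTop atTop

theorem IsSlowWeight.sum_norm_le {σ : ℕ → ℝ} (hσ : IsSlowWeight σ) (N : ℕ) :
    ∑ n ∈ Finset.range N, ‖(((∑ k ∈ Finset.range N, σ k)⁻¹ * σ n : ℝ) : ℂ)‖ ≤ 1 := by
  have hT : 0 ≤ ∑ k ∈ Finset.range N, σ k := Finset.sum_nonneg fun k _ => (hσ.pos k).le
  have : ∀ n, ‖(((∑ k ∈ Finset.range N, σ k)⁻¹ * σ n : ℝ) : ℂ)‖ =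
      (∑ k ∈ Finset.range N, σ k)⁻¹ * σ n := fun n => by
    rw [Complex.norm_real, Real.norm_of_nonneg (mul_nonneg (inv_nonneg.2 hT) (hσ.pos n).le)]
  simp only [this]
  rw [← Finset.mul_sum]
  exact inv_mul_le_one

/-- Dirichlet's test: the geometric sums are bounded and `σ` decreases to `0`, so the weighted
series converges, while the normalizing total diverges. -/
theorem IsSlowWeight.tendsto_weightedMean_pow {σ : ℕ → ℝ} (hσ : IsSlowWeight σ) {z : ℂ}
    (hz : ‖z‖ = 1) (hz1 : z ≠ 1) :
    Tendsto (weightedMean σ fun n => z ^ (n + 1)) atTop (𝓝 0) := by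
  have hbd : ∀ N, ‖∑ n ∈ Finset.range N, z ^ (n + 1)‖ ≤ 2 / ‖z - 1‖ := by
    intro N
    have : ∑ n ∈ Finset.range N, z ^ (n + 1) = z * ((z ^ N - 1) / (z - 1)) := by
      rw [← geom_sum_eq hz1, Finset.mul_sum]
      exact Finset.sum_congr rfl fun n _ => pow_succ' _ _
    rw [this, norm_mul, hz, one_mul, norm_div]
    gcongr
    calc ‖z ^ N - 1‖ ≤ ‖z ^ N‖ + ‖(1 : ℂ)‖ := norm_sub_le _ _
      _ = 2 := by rw [norm_pow, hz, one_pow, norm_one]; norm_num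
  obtain ⟨l, hl⟩ := cauchySeq_tendsto_of_complete
    (hσ.antitone.cauchySeq_series_mul_of_tendsto_zero_of_bounded hσ.tendsto_zero hbd)
  have hT : Tendsto (fun N => (((∑ k ∈ Finset.range N, σ k)⁻¹ : ℝ) : ℂ)) atTop (𝓝 0) := by
    have := (Complex.continuous_ofReal.tendsto 0).comp (tendsto_inv_atTop_zero.comp hσ.tendsto_sum)
    rwa [Complex.ofReal_zero] at this
  have := hT.mul hl
  rw [zero_mul] at this
  refine this.congr fun N => ?_
  rw [weightedMean_eq]
  simp only [Complex.real_smul]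

/-- Contractive functionals on continuous functions converge as soon as they converge on
characters. -/
theorem tendsto_of_tendsto_fourier {Λ : ℕ → C(UnitAddCircle, ℂ) →ₗ[ℂ] ℂ}
    {Λ' : C(UnitAddCircle, ℂ) →ₗ[ℂ] ℂ} (hΛ : ∀ N g, ‖Λ N g‖ ≤ ‖g‖) (hΛ' : ∀ g, ‖Λ' g‖ ≤ ‖g‖)
    (h : ∀ m : ℤ, Tendsto (fun N => Λ N (fourier m)) atTop (𝓝 (Λ' (fourier m))))
    (g : C(UnitAddCircle, ℂ)) : Tendsto (fun N => Λ N g) atTop (𝓝 (Λ' g)) := by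
  have hspan : ∀ p ∈ Submodule.span ℂ (Set.range (@fourier 1)),
      Tendsto (fun N => Λ N p) atTop (𝓝 (Λ' p)) := by
    intro p hp
    induction hp using Submodule.span_induction with
    | mem p hp => obtain ⟨m, rfl⟩ := hp; exact h m
    | zero => simp
    | add p q _ _ hp hq => simpa only [map_add] using hp.add hq
    | smul c p _ hp => simpa only [map_smul] using hp.const_smul c
  have hg : g ∈ closure (Submodule.span ℂ (Set.range (@fourier 1)) : Set C(UnitAddCircle, ℂ)) := by
    rw [← Submodule.topologicalClosure_coe, span_fourier_closure_eq_top]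
    trivial
  rw [Metric.tendsto_nhds]
  intro ε hε
  obtain ⟨p, hp, hgp⟩ := Metric.mem_closure_iff.1 hg (ε / 3) (by positivity)
  rw [dist_eq_norm] at hgp
  filter_upwards [Metric.tendsto_nhds.1 (hspan p hp) (ε / 3) (by positivity)] with N hN
  have h1 := (hΛ N (g - p)).trans_lt hgp
  have h2 := (hΛ' (g - p)).trans_lt hgp
  rw [map_sub, ← dist_eq_norm] at h1 h2
  calc dist (Λ N g) (Λ' g) ≤ dist (Λ N g) (Λ N p) + dist (Λ N p) (Λ' p) + dist (Λ' p) (Λ' g) :=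
        dist_triangle4 _ _ _ _
    _ < ε / 3 + ε / 3 + ε / 3 := by rw [dist_comm (Λ' p)]; gcongr
    _ = ε := by ring

/-- The functional sampling a function at the points `p n` with weights `a n`, for `n ∈ s`. -/
noncomputable def sampling (s : Finset ℕ) (a : ℕ → ℂ) (p : ℕ → UnitAddCircle) :
    C(UnitAddCircle, ℂ) →ₗ[ℂ] ℂ where
  toFun g := ∑ n ∈ s, a n * g (p n)
  map_add' g g' := by simp [mul_add, Finset.sum_add_distrib]
  map_smul' c g := by
    simp only [ContinuousMap.smul_apply, smul_eq_mul, RingHom.id_apply, Finset.mul_sum]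
    exact Finset.sum_congr rfl fun n _ => by ring

theorem sampling_apply (s : Finset ℕ) (a : ℕ → ℂ) (p : ℕ → UnitAddCircle)
    (g : C(UnitAddCircle, ℂ)) : sampling s a p g = ∑ n ∈ s, a n * g (p n) := rfl

theorem norm_sampling_le {s : Finset ℕ} {a : ℕ → ℂ} (ha : ∑ n ∈ s, ‖a n‖ ≤ 1)
    (p : ℕ → UnitAddCircle) (g : C(UnitAddCircle, ℂ)) : ‖sampling s a p g‖ ≤ ‖g‖ := by
  calc ‖sampling s a p g‖ ≤ ∑ n ∈ s, ‖a n‖ * ‖g‖ := by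
        refine norm_sum_le_of_le _ fun n _ => ?_
        rw [norm_mul]
        gcongr
        exact g.norm_coe_le_norm _
    _ = (∑ n ∈ s, ‖a n‖) * ‖g‖ := by rw [Finset.sum_mul]
    _ ≤ ‖g‖ := mul_le_of_le_one_left (norm_nonneg _) ha

theorem integrable_continuousMap (μ : Measure UnitAddCircle) [IsFiniteMeasure μ]
    {E : Type*} [NormedAddCommGroup E] (g : C(UnitAddCircle, E)) : Integrable g μ :=
  g.continuous.integrable_of_hasCompactSupport (HasCompactSupport.of_compactSpace _)

/-- Integration against a finite measure as a linear functional on continuous functions. -/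
noncomputable def integralFunctional (μ : Measure UnitAddCircle) [IsFiniteMeasure μ] :
    C(UnitAddCircle, ℂ) →ₗ[ℂ] ℂ where
  toFun g := ∫ x, g x ∂μ
  map_add' g g' := integral_add (integrable_continuousMap μ g) (integrable_continuousMap μ g')
  map_smul' c g := integral_const_mul c g

theorem integralFunctional_apply (μ : Measure UnitAddCircle) [IsFiniteMeasure μ]
    (g : C(UnitAddCircle, ℂ)) : integralFunctional μ g = ∫ x, g x ∂μ := rfl

theorem norm_integralFunctional_le (μ : Measure UnitAddCircle) [IsProbabilityMeasure μ]
    (g : C(UnitAddCircle, ℂ)) : ‖integralFunctional μ g‖ ≤ ‖g‖ := by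
  have := norm_integral_le_of_norm_le_const (μ := μ) (f := g) (C := ‖g‖)
    (Eventually.of_forall g.norm_coe_le_norm)
  simpa [integralFunctional_apply] using this

theorem IsSlowWeight.tendsto_weightedMean_orbit {σ : ℕ → ℝ} (hσ : IsSlowWeight σ)
    {a : UnitAddCircle} (ha : ∀ m : ℤ, m ≠ 0 → m • a ≠ 0) (g : C(UnitAddCircle, ℂ)) :
    Tendsto (weightedMean σ fun n => g ((n + 1) • a)) atTop (𝓝 (∫ x, g x)) := by
  refine tendsto_of_tendsto_fourier
    (Λ := fun N => sampling (Finset.range N)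
      (fun n => (((∑ k ∈ Finset.range N, σ k)⁻¹ * σ n : ℝ) : ℂ))
      fun n => (n + 1) • a) (Λ' := integralFunctional volume)
    (fun N => norm_sampling_le (hσ.sum_norm_le N) _) (norm_integralFunctional_le _) (fun m => ?_) g
  change Tendsto (weightedMean σ fun n => fourier m ((n + 1) • a)) _ (𝓝 (∫ x, fourier m x))
  simp only [fourier_nsmul]
  rcases eq_or_ne m 0 with rfl | hm
  · have hone : e ((0 : ℤ) • a) = 1 := e_eq_one_iff.2 (zero_smul _ _)
    simp only [hone, one_pow, fourier_zero, integral_const, probReal_univ, one_smul]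
    -- The mean of the constant `1` equals `1` only once the total weight is nonzero; for `N = 0` it
    -- is `0`.
    refine tendsto_const_nhds.congr' ?_
    filter_upwards [hσ.tendsto_sum.eventually_gt_atTop 0] with N hN
    rw [weightedMean_eq]
    simp only [mul_one]
    rw [← Complex.ofReal_sum, ← Complex.ofReal_mul, inv_mul_cancel₀ hN.ne', Complex.ofReal_one]
  · rw [integral_fourier_eq_zero hm]
    exact hσ.tendsto_weightedMean_pow (norm_e _) fun h => ha m hm (e_eq_one_iff.1 h)

/-- The factor `e ((n + 1) • β)` is absorbed into the weights. Each character then yields powers of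
`e (m • a + β) ≠ 1`, even for `m = 0`, so the limit functional vanishes. -/
theorem IsSlowWeight.tendsto_weightedMean_orbit_mul_e {σ : ℕ → ℝ} (hσ : IsSlowWeight σ)
    {a β : UnitAddCircle} (hβ : ∀ m : ℤ, m • a + β ≠ 0) (g : C(UnitAddCircle, ℂ)) :
    Tendsto (weightedMean σ fun n => g ((n + 1) • a) * e ((n + 1) • β)) atTop (𝓝 0) := by
  have hnorm : ∀ N, ∑ n ∈ Finset.range N,
      ‖(((∑ k ∈ Finset.range N, σ k)⁻¹ * σ n : ℝ) : ℂ) * e ((n + 1) • β)‖ ≤ 1 := by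
    intro N
    simp only [norm_mul, norm_e, mul_one]
    exact hσ.sum_norm_le N
  have key := tendsto_of_tendsto_fourier
    (Λ := fun N => sampling (Finset.range N)
      (fun n => (((∑ k ∈ Finset.range N, σ k)⁻¹ * σ n : ℝ) : ℂ) * e ((n + 1) • β))
      fun n => (n + 1) • a) (Λ' := 0)
    (fun N => norm_sampling_le (hnorm N) _) (fun g => by simp) (fun m => ?_) g
  · refine key.congr fun N => ?_
    rw [sampling_apply, weightedMean]
    exact Finset.sum_congr rfl fun n _ => by ring
  · refine (hσ.tendsto_weightedMean_pow (norm_e (m • a + β))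
      fun h => hβ m (e_eq_one_iff.1 h)).congr fun N => ?_
    rw [sampling_apply, weightedMean]
    refine Finset.sum_congr rfl fun n _ => ?_
    rw [fourier_nsmul, e_add, mul_pow, e_nsmul β]
    ring

/-- The weights `(n + 1) ^ (-1/8)`. -/
noncomputable def slowWeight (n : ℕ) : ℝ := ((n : ℝ) + 1) ^ (-(1 / 8) : ℝ)

theorem slowWeight_antitone : Antitone slowWeight := fun m n hmn =>
  Real.rpow_le_rpow_of_nonpos (by positivity) (by gcongr) (by norm_num)

/-- Each of the `N` terms is at least `N ^ (-1/8)`. What matters is that `7/8` exceeds the exponent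
`3/4` of the rounding error. -/
theorem le_sum_slowWeight (N : ℕ) :
    (N : ℝ) ^ (7 / 8 : ℝ) ≤ ∑ n ∈ Finset.range N, slowWeight n := by
  rcases Nat.eq_zero_or_pos N with rfl | hN
  · simp [Real.zero_rpow (show (7 / 8 : ℝ) ≠ 0 by norm_num)]
  have hN' : (0 : ℝ) < N := by exact_mod_cast hN
  calc (N : ℝ) ^ (7 / 8 : ℝ) = ∑ _n ∈ Finset.range N, (N : ℝ) ^ (-(1 / 8) : ℝ) := by
        rw [Finset.sum_const, Finset.card_range, nsmul_eq_mul]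
        nth_rewrite 2 [← Real.rpow_one (N : ℝ)]
        rw [← Real.rpow_add hN']
        norm_num
    _ ≤ _ := by
        refine Finset.sum_le_sum fun n hn => ?_
        refine Real.rpow_le_rpow_of_nonpos (by positivity) ?_ (by norm_num)
        exact_mod_cast Finset.mem_range.1 hn

theorem isSlowWeight_slowWeight : IsSlowWeight slowWeight where
  antitone := slowWeight_antitone
  tendsto_zero := (tendsto_rpow_neg_atTop (by norm_num)).comp
    (tendsto_atTop_add_const_right _ _ tendsto_natCast_atTop_atTop)
  pos n := Real.rpow_pos_of_pos (by positivity) _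
  tendsto_sum := tendsto_atTop_mono le_sum_slowWeight
    ((tendsto_rpow_atTop (by norm_num)).comp tendsto_natCast_atTop_atTop)

/-! ### Weights adapted to an integrable density -/

theorem exists_continuous_approx {f : UnitAddCircle → ℝ} (hf : Integrable f) (hf0 : ∀ x, 0 ≤ f x)
    {ε : ℝ} (hε : 0 < ε) :
    ∃ g : C(UnitAddCircle, ℝ), (∀ x, 0 ≤ g x) ∧ ∫ x, |g x - f x| ≤ ε := by
  obtain ⟨g, hg, hgi⟩ := hf.exists_boundedContinuous_integral_sub_le hε
  -- Taking the positive part does not increase the distance to the nonnegative `f`.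
  refine ⟨⟨fun x => max (g x) 0, g.continuous.max continuous_const⟩, fun x => le_max_right _ _,
    le_trans (integral_mono_of_nonneg (Eventually.of_forall fun x => abs_nonneg _)
      (hf.sub hgi).norm (Eventually.of_forall fun x => ?_)) hg⟩
  have := abs_max_sub_max_le_abs (g x) (f x) 0
  rw [max_eq_left (hf0 x)] at this
  simpa [abs_sub_comm] using this

/-- The zero function is a legitimate start because `∫ f ≤ 1 = (1/2) ^ 0`. It later serves as the
weight at times when no other approximant is yet admissible. -/
theorem exists_continuous_approx_seq {f : UnitAddCircle → ℝ} (hf : Integrable f)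
    (hf0 : ∀ x, 0 ≤ f x) (hf1 : ∫ x, f x ≤ 1) :
    ∃ F : ℕ → C(UnitAddCircle, ℝ), F 0 = 0 ∧ (∀ i x, 0 ≤ F i x) ∧
      ∀ i, ∫ x, |F i x - f x| ≤ (1 / 2 : ℝ) ^ i := by
  choose G hG0 hG using fun i : ℕ =>
    exists_continuous_approx hf hf0 (ε := (1 / 2 : ℝ) ^ i) (by positivity)
  refine ⟨fun i => if i = 0 then 0 else G i, if_pos rfl, fun i x => ?_, fun i => ?_⟩
  · dsimp only
    split_ifs
    · exact le_rfl
    · exact hG0 i x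
  · rcases eq_or_ne i 0 with rfl | hi
    · simpa [abs_of_nonneg (hf0 _)] using hf1
    · simpa only [if_neg hi] using hG i

theorem weightedMean_sub (σ : ℕ → ℝ) (u v : ℕ → ℂ) (N : ℕ) :
    weightedMean σ u N - weightedMean σ v N = weightedMean σ (u - v) N := by
  simp only [weightedMean, ← Finset.sum_sub_distrib, Pi.sub_apply, mul_sub]

theorem IsSlowWeight.norm_weightedMean_le {σ : ℕ → ℝ} (hσ : IsSlowWeight σ) {u : ℕ → ℂ} {d : ℕ → ℝ}
    (hu : ∀ n, ‖u n‖ ≤ d n) (N : ℕ) :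
    ‖weightedMean σ u N‖ ≤
      (∑ k ∈ Finset.range N, σ k)⁻¹ * ∑ n ∈ Finset.range N, σ n * d n := by
  have hT : 0 ≤ ∑ k ∈ Finset.range N, σ k := Finset.sum_nonneg fun k _ => (hσ.pos k).le
  rw [weightedMean_eq, norm_mul, Complex.norm_real, Real.norm_of_nonneg (inv_nonneg.2 hT)]
  gcongr
  refine norm_sum_le_of_le _ fun n _ => ?_
  rw [norm_mul, Complex.norm_real, Real.norm_of_nonneg (hσ.pos n).le]
  exact mul_le_mul_of_nonneg_left (hu n) (hσ.pos n).le

/-- Finitely many terms are negligible against the divergent total weight. -/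
theorem IsSlowWeight.tendsto_weightedMean_congr {σ : ℕ → ℝ} (hσ : IsSlowWeight σ) {u v : ℕ → ℂ}
    {l : ℂ} (hu : Tendsto (weightedMean σ u) atTop (𝓝 l)) (huv : u =ᶠ[atTop] v) :
    Tendsto (weightedMean σ v) atTop (𝓝 l) := by
  obtain ⟨M, hM⟩ := eventually_atTop.1 huv
  have hconst : Tendsto (fun N => ((∑ k ∈ Finset.range N, σ k)⁻¹ : ℝ) *
      ∑ n ∈ Finset.range M, (σ n : ℂ) * (v n - u n)) atTop (𝓝 0) := by
    have := ((Complex.continuous_ofReal.tendsto 0).comp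
      (tendsto_inv_atTop_zero.comp hσ.tendsto_sum)).mul_const
        (∑ n ∈ Finset.range M, (σ n : ℂ) * (v n - u n))
    rwa [Complex.ofReal_zero, zero_mul] at this
  have := hconst.add hu
  rw [zero_add] at this
  refine this.congr' ?_
  filter_upwards [eventually_ge_atTop M] with N hN
  rw [← eq_sub_iff_add_eq, weightedMean_sub, weightedMean_eq]
  congr 1
  refine Finset.sum_subset (Finset.range_mono hN) fun n _ hn => ?_
  rw [hM n (by simpa using hn), sub_self, mul_zero]

theorem IsSlowWeight.tendsto_mean_orbit_real {σ : ℕ → ℝ} (hσ : IsSlowWeight σ)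
    {a : UnitAddCircle} (ha : ∀ m : ℤ, m ≠ 0 → m • a ≠ 0) (g : C(UnitAddCircle, ℝ)) :
    Tendsto (fun N => (∑ k ∈ Finset.range N, σ k)⁻¹ *
      ∑ n ∈ Finset.range N, σ n * g ((n + 1) • a)) atTop (𝓝 (∫ x, g x)) := by
  have := hσ.tendsto_weightedMean_orbit ha ⟨fun x => (g x : ℂ), by fun_prop⟩
  simp only [ContinuousMap.coe_mk, integral_complex_ofReal] at this
  have := (Complex.continuous_re.tendsto _).comp this
  rw [Complex.ofReal_re] at this
  refine this.congr fun N => ?_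
  rw [Function.comp_apply, weightedMean_eq]
  norm_cast

theorem tendsto_of_approx {x l : ℕ → ℂ} {y : ℕ → ℕ → ℂ} {l' : ℂ} {ε : ℕ → ℝ}
    (hy : ∀ i, Tendsto (y i) atTop (𝓝 (l i))) (hl : Tendsto l atTop (𝓝 l'))
    (hε : Tendsto ε atTop (𝓝 0)) (hxy : ∀ i N, ‖x N - y i N‖ ≤ ε i) :
    Tendsto x atTop (𝓝 l') := by
  rw [Metric.tendsto_nhds]
  intro δ hδ
  obtain ⟨i, hi, hi'⟩ := ((Metric.tendsto_nhds.1 hl (δ / 3) (by positivity)).and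
    (hε.eventually_lt_const (show 0 < δ / 3 by positivity))).exists
  filter_upwards [Metric.tendsto_nhds.1 (hy i) (δ / 3) (by positivity)] with N hN
  have := hxy i N
  rw [← dist_eq_norm] at this
  calc dist (x N) l' ≤ dist (x N) (y i N) + dist (y i N) (l i) + dist (l i) l' :=
        dist_triangle4 _ _ _ _
    _ < δ / 3 + δ / 3 + δ / 3 := by
        refine add_lt_add (add_lt_add (this.trans_lt hi') hN) hi
    _ = δ := by ring

theorem sum_Ico_half_pow_le (i N : ℕ) :
    ∑ j ∈ Finset.Ico i N, (1 / 2 : ℝ) ^ j ≤ 2 * (1 / 2) ^ i := by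
  rcases le_or_gt i N with h | h
  · rw [geom_sum_Ico (by norm_num) h]
    have : (0 : ℝ) ≤ (1 / 2) ^ N := by positivity
    rw [show (1 / 2 - 1 : ℝ) = -(1 / 2) by norm_num, div_le_iff_of_neg (by norm_num)]
    linarith
  · rw [Finset.Ico_eq_empty (by omega), Finset.sum_empty]
    positivity

theorem integral_abs_sub_le {f : UnitAddCircle → ℝ} (hf : Integrable f)
    (g h : C(UnitAddCircle, ℝ)) :
    ∫ x, |h x - g x| ≤ (∫ x, |h x - f x|) + ∫ x, |g x - f x| := by
  have hgf : Integrable fun x => |g x - f x| := ((integrable_continuousMap volume g).sub hf).abs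
  have hhf : Integrable fun x => |h x - f x| := ((integrable_continuousMap volume h).sub hf).abs
  have hhg : Integrable fun x => |h x - g x| :=
    ((integrable_continuousMap volume h).sub (integrable_continuousMap volume g)).abs
  rw [← integral_add hhf hgf]
  refine integral_mono hhg (hhf.add hgf) fun x => ?_
  have := abs_sub_le (h x) (f x) (g x)
  rwa [abs_sub_comm (f x)] at this

/-- If the functions `F i` converge fast in the mean, then along any orbit of an irrational rotation
their values can be combined, with slowly growing index, into weights `w n ∈ [0, 1]` whose
correlations with a bounded sequence are the limits of those of the `F i`. -/
theorem IsSlowWeight.exists_weights {σ : ℕ → ℝ} (hσ : IsSlowWeight σ)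
    {a : UnitAddCircle} (ha : ∀ m : ℤ, m ≠ 0 → m • a ≠ 0) {F : ℕ → C(UnitAddCircle, ℝ)}
    (hF0 : F 0 = 0) (hF : ∀ i x, 0 ≤ F i x)
    (hint : ∀ i, ∫ x, |F i x - F (i + 1) x| < 2 * (1 / 2 : ℝ) ^ i) :
    ∃ w : ℕ → ℝ, (∀ n, 0 ≤ w n) ∧ (∀ n, w n ≤ 1) ∧ ∀ (c : ℕ → ℂ) (l : ℕ → ℂ) (l' : ℂ),
      (∀ n, ‖c n‖ ≤ 1) →
      (∀ i, Tendsto (weightedMean σ fun n => (F i ((n + 1) • a) : ℂ) * c n) atTop (𝓝 (l i))) →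
      Tendsto l atTop (𝓝 l') →
      Tendsto (fun N => ((∑ k ∈ Finset.range N, σ k)⁻¹ : ℝ) *
        ∑ n ∈ Finset.range N, (w n : ℂ) * c n) atTop (𝓝 l') := by
  let D : ℕ → ℕ → ℝ := fun j n => |F j ((n + 1) • a) - F (j + 1) ((n + 1) • a)|
  -- Equidistribution carries the strict inequality between integrals over to orbit means from some
  -- time on, and `σ` eventually compensates the sup norm of `F (j + 1)`.
  have hev : ∀ j, ∀ᶠ N in atTop, ∀ M ≥ N,
      (∑ k ∈ Finset.range M, σ k)⁻¹ * ∑ n ∈ Finset.range M, σ n * D j n ≤ 2 * (1 / 2 : ℝ) ^ j ∧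
        σ M * ‖F (j + 1)‖ ≤ 1 := by
    intro j
    refine eventually_forall_ge_atTop.2 (Eventually.and ?_ ?_)
    · exact ((hσ.tendsto_mean_orbit_real ha |F j - F (j + 1)|).eventually_lt_const
        (hint j)).mono fun N hN => hN.le
    · have := hσ.tendsto_zero.mul_const ‖F (j + 1)‖
      rw [zero_mul] at this
      exact (this.eventually_lt_const one_pos).mono fun N hN => hN.le
  obtain ⟨φ, hφ, hφD⟩ := extraction_forall_of_eventually hev
  have hex : ∀ n, ∃ j, n < φ j := fun n => ⟨n + 1, (Nat.lt_succ_self n).trans_le (hφ.id_le _)⟩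
  -- `F (j + 1)` is in use exactly for `φ j ≤ n < φ (j + 1)`, and `F 0 = 0` before `φ 0`.
  let k : ℕ → ℕ := fun n => Nat.find (hex n)
  have hk : ∀ n j, j < k n ↔ φ j ≤ n := by
    intro n j
    rw [Nat.lt_find_iff]
    exact ⟨fun h => not_lt.1 (h j le_rfl),
      fun h m hm => not_lt.2 ((hφ.monotone hm).trans h)⟩
  refine ⟨fun n => σ n * F (k n) ((n + 1) • a), fun n => mul_nonneg (hσ.pos n).le (hF _ _),
    fun n => ?_, fun c l l' hc hl hl' => ?_⟩
  · rcases Nat.eq_zero_or_pos (k n) with h | h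
    · simp [h, hF0]
    · obtain ⟨j, hj⟩ := Nat.exists_eq_succ_of_ne_zero h.ne'
      have hjn : φ j ≤ n := (hk n j).1 (by omega)
      refine le_trans ?_ (hφD j n hjn).2
      simp only [hj]
      exact mul_le_mul_of_nonneg_left ((le_abs_self _).trans ((F (j + 1)).norm_coe_le_norm _))
        (hσ.pos n).le
  let d : ℕ → ℕ → ℝ := fun i n => ∑ j ∈ Finset.Ico i (k n), D j n
  have hd : ∀ i n, |F (k n) ((n + 1) • a) - F (min (k n) i) ((n + 1) • a)| ≤ d i n := by
    intro i n
    rcases le_total (k n) i with h | h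
    · rw [min_eq_left h, sub_self, abs_zero]
      exact Finset.sum_nonneg fun j _ => abs_nonneg _
    · rw [min_eq_right h, abs_sub_comm]
      exact dist_le_Ico_sum_dist (fun j => F j ((n + 1) • a)) h
  -- The bound has to hold for every `N`. The difference `D j` enters only at times `n ≥ φ j`: if `φ
  -- j > N` it contributes nothing, and otherwise its full orbit mean up to `N` is already small.
  have hd_mean : ∀ i N, (∑ k ∈ Finset.range N, σ k)⁻¹ * ∑ n ∈ Finset.range N, σ n * d i n ≤
      4 * (1 / 2 : ℝ) ^ i := by
    intro i N
    have hT : 0 ≤ (∑ k ∈ Finset.range N, σ k)⁻¹ :=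
      inv_nonneg.2 (Finset.sum_nonneg fun k _ => (hσ.pos k).le)
    have hnn : ∀ j n, 0 ≤ σ n * D j n := fun j n => mul_nonneg (hσ.pos n).le (abs_nonneg _)
    -- Since `j ≤ φ j ≤ n < N`, the range `j < k n` lies below `N`.
    have hswap : ∑ n ∈ Finset.range N, σ n * d i n =
        ∑ j ∈ Finset.Ico i N, ∑ n ∈ Finset.range N, if φ j ≤ n then σ n * D j n else 0 := by
      rw [Finset.sum_comm]
      refine Finset.sum_congr rfl fun n hn => ?_
      rw [← Finset.sum_filter, Finset.mul_sum]
      refine Finset.sum_congr ?_ fun _ _ => rfl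
      ext j
      simp only [Finset.mem_Ico, Finset.mem_filter, hk]
      have := hφ.id_le j
      have := Finset.mem_range.1 hn
      simp only [id_eq] at *
      omega
    calc _ = ∑ j ∈ Finset.Ico i N, (∑ k ∈ Finset.range N, σ k)⁻¹ *
          ∑ n ∈ Finset.range N, if φ j ≤ n then σ n * D j n else 0 := by
            rw [hswap, Finset.mul_sum]
      _ ≤ ∑ j ∈ Finset.Ico i N, 2 * (1 / 2 : ℝ) ^ j := by
          refine Finset.sum_le_sum fun j _ => ?_
          rcases le_or_gt (φ j) N with h | h
          · refine le_trans (mul_le_mul_of_nonneg_left (Finset.sum_le_sum fun n _ => ?_) hT)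
              (hφD j N h).1
            split_ifs
            · exact le_rfl
            · exact hnn j n
          · have hzero : (∑ n ∈ Finset.range N, if φ j ≤ n then σ n * D j n else 0) = 0 := by
              refine Finset.sum_eq_zero fun n hn => if_neg ?_
              have := Finset.mem_range.1 hn
              omega
            rw [hzero, mul_zero]
            positivity
      _ ≤ 4 * (1 / 2 : ℝ) ^ i := by
          rw [← Finset.mul_sum]
          linarith [sum_Ico_half_pow_le i N]
  -- The cap `min (k n) i` equals `i` from `φ i` on, which leaves the limit unchanged, and it keeps
  -- the comparison with `F (k n)` valid at early times as well.
  have hlim : ∀ i, Tendsto (weightedMean σ fun n => (F (min (k n) i) ((n + 1) • a) : ℂ) * c n)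
      atTop (𝓝 (l i)) := by
    intro i
    refine hσ.tendsto_weightedMean_congr (hl i) ?_
    filter_upwards [eventually_ge_atTop (φ i)] with n hn
    rw [min_eq_right ((hk n i).2 hn).le]
  have hε : Tendsto (fun i : ℕ => 4 * (1 / 2 : ℝ) ^ i) atTop (𝓝 0) := by
    have := (tendsto_pow_atTop_nhds_zero_of_lt_one (r := (1 / 2 : ℝ)) (by norm_num)
      (by norm_num)).const_mul 4
    rwa [mul_zero] at this
  have key : Tendsto (weightedMean σ fun n => (F (k n) ((n + 1) • a) : ℂ) * c n) atTop (𝓝 l') := by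
    refine tendsto_of_approx hlim hl' hε fun i N => ?_
    rw [weightedMean_sub]
    refine (hσ.norm_weightedMean_le (d := d i) (fun n => ?_) N).trans (hd_mean i N)
    rw [Pi.sub_apply, ← sub_mul, norm_mul, ← Complex.ofReal_sub, Complex.norm_real]
    exact (mul_le_of_le_one_right (norm_nonneg _) (hc n)).trans (hd i n)
  refine key.congr fun N => ?_
  rw [weightedMean_eq]
  congr 1
  refine Finset.sum_congr rfl fun n _ => ?_
  push_cast
  ring

/-! ### Construction of the representing set -/

theorem tendsto_inv_sum_mul_of_sq_norm_le {R : ℕ → ℂ}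
    (hR : ∀ N : ℕ, ‖R N‖ ^ 2 ≤ N + 2 * (Real.sqrt N * N)) :
    Tendsto (fun N => ((∑ k ∈ Finset.range N, slowWeight k)⁻¹ : ℝ) * R N) atTop (𝓝 0) := by
  have hlim : Tendsto (fun N : ℕ => 2 * (N : ℝ) ^ (-(1 / 8) : ℝ)) atTop (𝓝 0) := by
    have := ((tendsto_rpow_neg_atTop (y := 1 / 8) (by norm_num)).comp
      tendsto_natCast_atTop_atTop).const_mul 2
    rwa [mul_zero] at this
  refine squeeze_zero_norm' ?_ hlim
  filter_upwards [eventually_ge_atTop 1] with N hN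
  have hN1 : (1 : ℝ) ≤ N := by exact_mod_cast hN
  have hN0 : (0 : ℝ) < N := by linarith
  have hpow : (N : ℝ) ^ (3 / 4 : ℝ) * (N : ℝ) ^ (3 / 4 : ℝ) = Real.sqrt N * N := by
    rw [Real.sqrt_eq_rpow, ← Real.rpow_add hN0]
    nth_rewrite 3 [← Real.rpow_one (N : ℝ)]
    rw [← Real.rpow_add hN0]
    norm_num
  have hRN : ‖R N‖ ≤ 2 * (N : ℝ) ^ (3 / 4 : ℝ) := by
    refine abs_le_of_sq_le_sq' ?_ (by positivity) |>.2
    -- With `N ≤ √N * N` the hypothesis gives `‖R N‖ ^ 2 ≤ 3 * N ^ (3/2)`, below the square of the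
    -- claimed bound.
    have h1 : (1 : ℝ) ≤ Real.sqrt N := Real.one_le_sqrt.2 hN1
    nlinarith [hR N]
  have hT : (∑ k ∈ Finset.range N, slowWeight k)⁻¹ ≤ (N : ℝ) ^ (-(7 / 8) : ℝ) := by
    rw [Real.rpow_neg hN0.le]
    exact inv_anti₀ (by positivity) (le_sum_slowWeight N)
  have hT0 : 0 ≤ (∑ k ∈ Finset.range N, slowWeight k)⁻¹ :=
    inv_nonneg.2 (Finset.sum_nonneg fun k _ => (isSlowWeight_slowWeight.pos k).le)
  calc _ = (∑ k ∈ Finset.range N, slowWeight k)⁻¹ * ‖R N‖ := by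
        rw [norm_mul, Complex.norm_real, Real.norm_of_nonneg hT0]
    _ ≤ (N : ℝ) ^ (-(7 / 8) : ℝ) * (2 * (N : ℝ) ^ (3 / 4 : ℝ)) := by gcongr
    _ = 2 * (N : ℝ) ^ (-(1 / 8) : ℝ) := by
        rw [mul_left_comm, ← Real.rpow_add hN0]
        norm_num

/-- The shift by one makes the chosen integers positive and matches the orbit points `(n + 1) • a`.
-/
theorem sum_initSegment_succ_image (A : Set ℕ) (N : ℕ) (f : ℕ → ℂ) :
    ∑ s ∈ initSegment (Nat.succ '' A) N, f s =
      ∑ n ∈ Finset.range N, ((A.indicator 1 n : ℝ) : ℂ) * f (n + 1) := by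
  classical
  have himage : initSegment (Nat.succ '' A) N =
      ((Finset.range N).filter (· ∈ A)).map ⟨Nat.succ, Nat.succ_injective⟩ := by
    ext s
    simp only [initSegment, Finset.mem_filter, Finset.mem_Icc, Set.mem_image, Finset.mem_map,
      Finset.mem_range, Function.Embedding.coeFn_mk]
    constructor
    · rintro ⟨⟨-, hs⟩, n, hn, rfl⟩
      exact ⟨n, ⟨hs, hn⟩, rfl⟩
    · rintro ⟨n, ⟨hnN, hn⟩, rfl⟩
      exact ⟨⟨Nat.succ_pos n, hnN⟩, n, hn, rfl⟩
  rw [himage, Finset.sum_map, Finset.sum_filter]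
  refine Finset.sum_congr rfl fun n _ => ?_
  by_cases hn : n ∈ A <;> simp [hn]

theorem sum_norm_arithAverage_le (B : Finset ℕ) :
    ∑ _s ∈ B, ‖(B.card : ℂ)⁻¹‖ ≤ 1 := by
  rw [Finset.sum_const, nsmul_eq_mul, norm_inv, Complex.norm_natCast]
  exact mul_inv_le_one

/-- For a finite set the counts are bounded, so the normalized counts would tend to `0`. -/
theorem infinite_of_tendsto_card {S : Set ℕ} {c : ℕ → ℝ} {l : ℂ} (hl : l ≠ 0)
    (hc : Tendsto c atTop (𝓝 0))
    (h : Tendsto (fun N => (c N : ℂ) * ((initSegment S N).card : ℂ)) atTop (𝓝 l)) :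
    S.Infinite := by
  intro hS
  refine hl (tendsto_nhds_unique h ?_)
  have hlim : Tendsto (fun N => |c N| * S.ncard) atTop (𝓝 0) := by
    simpa using hc.abs.mul_const (S.ncard : ℝ)
  refine squeeze_zero_norm (fun N => ?_) hlim
  rw [norm_mul, Complex.norm_real, Complex.norm_natCast, Real.norm_eq_abs]
  gcongr
  rw [← Set.ncard_coe_finset]
  refine Set.ncard_le_ncard (fun s hs => ?_) hS
  simp only [initSegment, Finset.coe_filter, Set.mem_ofPred_eq] at hs
  exact hs.2

theorem Represents.of_tendsto_fourier {S : Set ℕ} {ν : Measure UnitAddCircle}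
    [IsProbabilityMeasure ν] {a : UnitAddCircle} (hS : IsGoodSet S)
    (h : ∀ m : ℤ, Tendsto (fun N : ℕ => arithAverage (initSegment S N) fun s => e (s • m • a)) atTop
      (𝓝 (∫ x, fourier m x ∂ν))) :
    Represents S ν a := by
  refine ⟨hS, fun φ => ?_⟩
  rw [measure_univ, inv_one, one_smul]
  have key := tendsto_of_tendsto_fourier
    (Λ := fun N => sampling (initSegment S N) (fun _ => ((initSegment S N).card : ℂ)⁻¹)
      fun s => s • a) (Λ' := integralFunctional ν)
    (fun N => norm_sampling_le (sum_norm_arithAverage_le _) _) (norm_integralFunctional_le ν)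
    (fun m => (h m).congr fun N => ?_) φ
  · refine key.congr fun N => ?_
    rw [sampling_apply, arithAverage, Finset.mul_sum]
  · rw [sampling_apply, arithAverage, Finset.mul_sum]
    refine Finset.sum_congr rfl fun s _ => ?_
    rw [fourier_eq_e, smul_comm]

theorem tendsto_integral_mul_fourier {f : UnitAddCircle → ℝ} (hf : Integrable f)
    {F : ℕ → C(UnitAddCircle, ℝ)} (hF : ∀ i, ∫ x, |F i x - f x| ≤ (1 / 2 : ℝ) ^ i) (m : ℤ) :
    Tendsto (fun i => ∫ x, (F i x : ℂ) * fourier m x) atTop (𝓝 (∫ x, (f x : ℂ) * fourier m x)) := by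
  rw [tendsto_iff_norm_sub_tendsto_zero]
  refine squeeze_zero (fun _ => norm_nonneg _) (fun i => ?_)
    (tendsto_pow_atTop_nhds_zero_of_lt_one (r := (1 / 2 : ℝ)) (by norm_num) (by norm_num))
  have hmul : ∀ {u : UnitAddCircle → ℝ}, Integrable u →
      Integrable fun x => (u x : ℂ) * fourier m x := fun hu =>
    hu.ofReal.mul_bdd (c := 1) (fourier m).continuous.aestronglyMeasurable
      (Eventually.of_forall fun x => (norm_fourier_apply m x).le)
  rw [← integral_sub (hmul (integrable_continuousMap volume (F i))) (hmul hf)]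
  refine (norm_integral_le_integral_norm _).trans (le_trans (le_of_eq ?_) (hF i))
  refine integral_congr_ae (Eventually.of_forall fun x => ?_)
  dsimp only
  rw [← sub_mul, norm_mul, norm_fourier_apply, mul_one, ← Complex.ofReal_sub, Complex.norm_real,
    Real.norm_eq_abs]

theorem zsmul_coe_ne_zero {α : ℝ} (hα : Irrational α) {m : ℤ} (hm : m ≠ 0) :
    m • (α : UnitAddCircle) ≠ 0 := by
  intro h
  rw [← AddCircle.coe_zsmul, AddCircle.coe_eq_zero_iff] at h
  obtain ⟨n, hn⟩ := h
  rw [zsmul_eq_mul, zsmul_eq_mul, mul_one] at hn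
  exact (hα.intCast_mul hm).ne_int n hn.symm

end RepresentableMeasure

open RepresentableMeasure Filter Topology MeasureTheory in
theorem mainTheorem4 (ν : MeasureTheory.Measure UnitAddCircle)
    [MeasureTheory.IsProbabilityMeasure ν]
    (hν : MeasureTheory.Measure.AbsolutelyContinuous ν
      (MeasureTheory.volume : MeasureTheory.Measure UnitAddCircle))
    (α : ℝ) (hα : Irrational α) :
    RepresentableMeasure.IsRepresentableAt ν (α : UnitAddCircle) := by
  have ha : ∀ m : ℤ, m ≠ 0 → m • (α : UnitAddCircle) ≠ 0 := fun m => zsmul_coe_ne_zero hα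
  set a : UnitAddCircle := (α : UnitAddCircle)
  have hσ := isSlowWeight_slowWeight
  let f : UnitAddCircle → ℝ := fun x => (ν.rnDeriv volume x).toReal
  have hf : Integrable f := Measure.integrable_toReal_rnDeriv
  have hf1 : ∫ x, f x = 1 := by
    simpa [f] using integral_rnDeriv_smul (f := fun _ => (1 : ℝ)) hν
  have hfν : ∀ m : ℤ, ∫ x, (f x : ℂ) * fourier m x = ∫ x, fourier m x ∂ν := fun m =>
    integral_rnDeriv_smul (f := fun x => (fourier m x : ℂ)) hν
  obtain ⟨F, hF0, hFnn, hF⟩ :=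
    exists_continuous_approx_seq hf (fun x => ENNReal.toReal_nonneg) hf1.le
  have hint : ∀ i, ∫ x, |F i x - F (i + 1) x| < 2 * (1 / 2 : ℝ) ^ i := by
    intro i
    have h1 := integral_abs_sub_le hf (F (i + 1)) (F i)
    have h2 := hF (i + 1)
    rw [pow_succ] at h2
    have h3 : (0 : ℝ) < (1 / 2) ^ i := by positivity
    linarith [hF i]
  obtain ⟨w, hw0, hw1, hw⟩ := hσ.exists_weights ha hF0 hFnn hint
  obtain ⟨A, hA⟩ := exists_rounding w hw0 hw1
  have htransfer : ∀ (β : UnitAddCircle) (l : ℂ),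
      Tendsto (fun N => ((∑ k ∈ Finset.range N, slowWeight k)⁻¹ : ℝ) *
        ∑ n ∈ Finset.range N, (w n : ℂ) * e ((n + 1) • β)) atTop (𝓝 l) →
      Tendsto (fun N => ((∑ k ∈ Finset.range N, slowWeight k)⁻¹ : ℝ) *
        ∑ s ∈ initSegment (Nat.succ '' A) N, e (s • β)) atTop (𝓝 l) := by
    intro β l hl
    -- The unimodular factor `e β` accounts for the shift from `n` to `n + 1`.
    have hR := tendsto_inv_sum_mul_of_sq_norm_le
      (R := fun N => e β * ∑ n ∈ Finset.range N, ((A.indicator 1 n - w n : ℝ) : ℂ) * e β ^ n)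
      fun N => by
        rw [norm_mul, norm_e, one_mul]
        exact hA N _ (norm_e β)
    have := hl.add hR
    rw [add_zero] at this
    refine this.congr fun N => ?_
    rw [← mul_add, sum_initSegment_succ_image, Finset.mul_sum, ← Finset.sum_add_distrib]
    congr 1
    refine Finset.sum_congr rfl fun n _ => ?_
    rw [e_nsmul, Complex.ofReal_sub]
    ring
  have hres : ∀ m : ℤ, Tendsto (fun N => ((∑ k ∈ Finset.range N, slowWeight k)⁻¹ : ℝ) *
      ∑ s ∈ initSegment (Nat.succ '' A) N, e (s • m • a)) atTop (𝓝 (∫ x, fourier m x ∂ν)) := by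
    intro m
    refine htransfer _ _ (hw _ (fun i => ∫ x, (F i x : ℂ) * fourier m x) _
      (fun n => (norm_e _).le) (fun i => ?_) ?_)
    · have := hσ.tendsto_weightedMean_orbit ha
        (⟨fun x => (F i x : ℂ), by fun_prop⟩ * fourier m)
      simp only [ContinuousMap.mul_apply, ContinuousMap.coe_mk, fourier_eq_e m (_ • a),
        smul_comm m _ a] at this
      exact this
    · rw [← hfν m]
      exact tendsto_integral_mul_fourier hf hF m
  have hnonres : ∀ β : UnitAddCircle, (∀ m : ℤ, m • a + β ≠ 0) →
      Tendsto (fun N => ((∑ k ∈ Finset.range N, slowWeight k)⁻¹ : ℝ) *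
        ∑ s ∈ initSegment (Nat.succ '' A) N, e (s • β)) atTop (𝓝 0) := fun β hβ =>
    htransfer _ _ (hw _ (fun _ => 0) _ (fun n => (norm_e _).le)
      (fun i => hσ.tendsto_weightedMean_orbit_mul_e hβ ⟨fun x => (F i x : ℂ), by fun_prop⟩)
      tendsto_const_nhds)
  have hcard : Tendsto (fun N => ((∑ k ∈ Finset.range N, slowWeight k)⁻¹ : ℝ) *
      ((initSegment (Nat.succ '' A) N).card : ℂ)) atTop (𝓝 1) := by
    have := hres 0
    have h0 : e (0 : UnitAddCircle) = 1 := e_eq_one_iff.2 rfl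
    simpa [h0] using this
  have hratio : ∀ (β : UnitAddCircle) (l : ℂ),
      Tendsto (fun N => ((∑ k ∈ Finset.range N, slowWeight k)⁻¹ : ℝ) *
        ∑ s ∈ initSegment (Nat.succ '' A) N, e (s • β)) atTop (𝓝 l) →
      Tendsto (fun N : ℕ => arithAverage (initSegment (Nat.succ '' A) N) fun s => e (s • β)) atTop
        (𝓝 l) := by
    intro β l hl
    have := hl.div hcard one_ne_zero
    rw [div_one] at this
    refine this.congr' ?_
    filter_upwards [hσ.tendsto_sum.eventually_gt_atTop 0] with N hN
    rw [arithAverage, Pi.div_apply, mul_div_mul_left, div_eq_inv_mul]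
    exact Complex.ofReal_ne_zero.2 (inv_ne_zero hN.ne')
  have hgood : IsGoodSet (Nat.succ '' A) := by
    refine ⟨?_, infinite_of_tendsto_card one_ne_zero
      (tendsto_inv_atTop_zero.comp hσ.tendsto_sum) hcard, fun β => ?_⟩
    · rintro _ ⟨n, -, rfl⟩
      exact Nat.succ_pos n
    -- Either `β` is no multiple of `a` and the limit is `0`, or it is one and the limit is a
    -- Fourier coefficient of `ν`.
    · by_cases hβ : ∀ m : ℤ, m • a + β ≠ 0
      · exact ⟨0, hratio β 0 (hnonres β hβ)⟩
      · push Not at hβ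
        obtain ⟨m, hm⟩ := hβ
        have hβm : β = (-m) • a := by rw [neg_smul]; exact eq_neg_of_add_eq_zero_right hm
        rw [hβm]
        exact ⟨_, hratio _ _ (hres (-m))⟩
  exact ⟨_, Represents.of_tendsto_fourier hgood fun m => hratio _ _ (hres m)⟩
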